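/- A symmetric Wente torus is a closed surface of genus one immersed in $\mathbb{R}^3$ with constant mean curvature, all of whose principal curves (lines of curvature) in one of the two principal families are planar. In detail, let $\Gamma \subset \mathbb{C}$ be a lattice and let $\mathcal{X} : \mathbb{C}/\Gamma \to \mathbb{R}^3$ be a smooth conformal immersion with smooth unit normal field $\vec N$, and put $z = x+iy$. Write the first fundamental form as $E\,(dx^2+dy^2)$ and the second fundamental form as $\langle d\mathcal{X}, d\vec N\rangle = L\,dx^2 + 2M\,dx\,dy + N\,dy^2$. Assume that the mean curvature $\frac{L+N}{2E}$ is a constant $H>0$, and that the coordinate $z$ is normalized so that the Hopf differential is $\left(\tfrac12(L-N)-iM\right)dz^2 = dz^2$; then the coordinate curves $\{x = \mathrm{const}\}$ and $\{y=\mathrm{const}\}$ are the principal curves. Assume finally that $\mathcal{X}$ maps every curve $\{x=x_0\}$ into a plane, or every curve $\{y=y_0\}$ into a plane. Define $F$ by $HE = e^F$, and let $$\mathcal{L}(u) = -\triangle u - V u, \qquad V = 4H\cosh F, \qquad \triangle = \frac{\partial^2}{\partial x^2} + \frac{\partial^2}{\partial y^2},$$ be the Jacobi operator on $C^\infty(\mathbb{C}/\Gamma)$.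 Its nullity $\mathrm{Null}(\mathcal{L})$ is the multiplicity of the eigenvalue $0$, that is, the dimension of $\{u \in C^\infty(\mathbb{C}/\Gamma) : \mathcal{L}(u)=0\}$. **Lemma.** For every symmetric Wente torus: 1. for all $a, b \in \mathbb{R}^3$, the normal part $\langle a + b\times \mathcal{X}, \vec N\rangle$ of the infinitesimal rigid motion $p \mapsto a + b\times p$ of $\mathbb{R}^3$ is a Jacobi field, i.e. it belongs to $C^\infty(\mathbb{C}/\Gamma)$ and is annihilated by $\mathcal{L}$; 2. this normal part vanishes identically only if $a=b=0$ (no nontrivial infinitesimal rigid motion is everywhere tangent to the surface), so that six linearly independent infinitesimal rigid motions give six linearly independent Jacobi fields; 3. $\mathrm{Null}(\mathcal{L}) \ge 6$. -/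

import Mathlib

open scoped ContDiff Matrix

noncomputable section

namespace Wente

/-- Euclidean three-space. -/
abbrev E3 : Type := EuclideanSpace ℝ (Fin 3)

/-- The partial derivative `∂/∂x` of a map on the plane `ℂ ∋ z = x + i y`. -/
def dX {G : Type*} [NormedAddCommGroup G] [NormedSpace ℝ G] (f : ℂ → G) (z : ℂ) : G :=
  fderiv ℝ f z 1

/-- The partial derivative `∂/∂y` of a map on the plane `ℂ ∋ z = x + i y`. -/
def dY {G : Type*} [NormedAddCommGroup G] [NormedSpace ℝ G] (f : ℂ → G) (z : ℂ) : G :=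
  fderiv ℝ f z Complex.I

/-- A map on the plane descends to the quotient `ℂ / Γ`. -/
def IsPeriodic {G : Type*} (Γ : Submodule ℤ ℂ) (f : ℂ → G) : Prop :=
  ∀ γ ∈ Γ, ∀ z, f (z + γ) = f z

/-- The coefficient `E` of the first fundamental form `E (dx² + dy²)` of a conformal map. -/
def metricE (X : ℂ → E3) (z : ℂ) : ℝ := inner ℝ (dX X z) (dX X z)

/-- The coefficient `L` of the second fundamental form `L dx² + 2 M dx dy + N dy²`
(which is `⟪dX, dν⟫`, so that `L = ⟪X_x, ν_x⟫ = - ⟪X_xx, ν⟫`). -/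
def sffL (X ν : ℂ → E3) (z : ℂ) : ℝ := -inner ℝ (dX (dX X) z) (ν z)

/-- The coefficient `M` of the second fundamental form. -/
def sffM (X ν : ℂ → E3) (z : ℂ) : ℝ := -inner ℝ (dY (dX X) z) (ν z)

/-- The coefficient `N` of the second fundamental form. -/
def sffN (X ν : ℂ → E3) (z : ℂ) : ℝ := -inner ℝ (dY (dY X) z) (ν z)

/-- The mean curvature `(L + N) / (2 E)`. -/
def meanCurvature (X ν : ℂ → E3) (z : ℂ) : ℝ :=
  (sffL X ν z + sffN X ν z) / (2 * metricE X z)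

/-- The Hopf differential coefficient `Φ = (L - N) / 2 - i M`. -/
def hopf (X ν : ℂ → E3) (z : ℂ) : ℂ :=
  (((sffL X ν z - sffN X ν z) / 2 : ℝ) : ℂ) - Complex.I * (sffM X ν z : ℂ)

/-- The map carries a subset `S` of the parameter plane into some affine plane of `ℝ³`. -/
def IsPlanarOn (X : ℂ → E3) (S : Set ℂ) : Prop :=
  ∃ (m : E3) (c : ℝ), m ≠ 0 ∧ ∀ z ∈ S, inner ℝ m (X z) = c

/-- `X : ℂ / Γ → ℝ³` with unit normal `ν` is a symmetric Wente torus: a smooth conformal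
immersion of a torus with constant mean curvature `H > 0`, in conformal coordinates for which
`Φ dz² = dz²` (so that the coordinate lines are the principal curves), such that all the
curves of one of the two families of principal curves are planar. -/
structure IsSymmetricWenteTorus (Γ : Submodule ℤ ℂ) (H : ℝ) (X ν : ℂ → E3) : Prop where
  smooth : ContDiff ℝ ∞ X
  periodic : IsPeriodic Γ X
  smooth_normal : ContDiff ℝ ∞ ν
  periodic_normal : IsPeriodic Γ ν
  immersion : ∀ z, Function.Injective (fderiv ℝ X z)
  conformal_norm : ∀ z, inner ℝ (dX X z) (dX X z) = inner ℝ (dY X z) (dY X z)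
  conformal_angle : ∀ z, inner ℝ (dX X z) (dY X z) = 0
  unit_normal : ∀ z, ‖ν z‖ = 1
  normal_dX : ∀ z, inner ℝ (dX X z) (ν z) = 0
  normal_dY : ∀ z, inner ℝ (dY X z) (ν z) = 0
  pos : 0 < H
  cmc : ∀ z, meanCurvature X ν z = H
  hopf_eq_one : ∀ z, hopf X ν z = 1
  planar : (∀ x₀ : ℝ, IsPlanarOn X {z | z.re = x₀}) ∨ (∀ y₀ : ℝ, IsPlanarOn X {z | z.im = y₀})

/-- The function `F` with `H E = e^F`. -/
def logMetric (H : ℝ) (X : ℂ → E3) (z : ℂ) : ℝ := Real.log (H * metricE X z)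

/-- The potential function `V = 4 H cosh F`. -/
def potential (H : ℝ) (X : ℂ → E3) (z : ℂ) : ℝ := 4 * H * Real.cosh (logMetric H X z)

/-- The operator `-Δ - V`, with the flat Laplacian `Δ = ∂²/∂x² + ∂²/∂y²`. -/
def schrodinger (V : ℂ → ℝ) (u : ℂ → ℝ) (z : ℂ) : ℝ :=
  -(Laplacian.laplacian u z) - V z * u z

/-- The eigenspace for the eigenvalue `0` of the operator `-Δ - V` on `C^∞(ℂ / Γ)`. -/
def nullSpace (Γ : Submodule ℤ ℂ) (V : ℂ → ℝ) : Submodule ℝ (ℂ → ℝ) where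
  carrier := {u | ContDiff ℝ ∞ u ∧ IsPeriodic Γ u ∧ ∀ z, schrodinger V u z = 0}
  zero_mem' := by
    refine ⟨contDiff_const, fun _ _ _ => rfl, fun z => ?_⟩
    have h : Laplacian.laplacian (0 : ℂ → ℝ) z = 0 :=
      congrFun (InnerProductSpace.laplacian_const (c := (0 : ℝ))) z
    simp [schrodinger, h]
  add_mem' := by
    rintro u v ⟨hu, pu, eu⟩ ⟨hv, pv, ev⟩
    refine ⟨hu.add hv, fun γ hγ z => ?_, fun z => ?_⟩
    · simp [pu γ hγ z, pv γ hγ z]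
    · have hL := ContDiffAt.laplacian_add
        ((hu.of_le (WithTop.coe_le_coe.2 (le_top : (2 : ℕ∞) ≤ ⊤))).contDiffAt (x := z))
        ((hv.of_le (WithTop.coe_le_coe.2 (le_top : (2 : ℕ∞) ≤ ⊤))).contDiffAt (x := z))
      have h1 := eu z
      have h2 := ev z
      simp only [schrodinger, Pi.add_apply] at h1 h2 ⊢
      rw [hL]
      linear_combination h1 + h2
  smul_mem' := by
    rintro c u ⟨hu, pu, eu⟩
    refine ⟨contDiff_const.smul hu, fun γ hγ z => ?_, fun z => ?_⟩
    · simp [pu γ hγ z]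
    · have hL := InnerProductSpace.laplacian_smul c
        ((hu.of_le (WithTop.coe_le_coe.2 (le_top : (2 : ℕ∞) ≤ ⊤))).contDiffAt (x := z))
      have h1 := eu z
      simp only [schrodinger, Pi.smul_apply, smul_eq_mul] at h1 hL ⊢
      rw [hL]
      linear_combination c * h1

/-- The Jacobi fields of the surface: the solutions `u ∈ C^∞(ℂ / Γ)` of `𝓛 u = 0`, where
`𝓛 = -Δ - V` is the Jacobi operator, with `V = 4 H cosh F`. -/
def jacobiFields (Γ : Submodule ℤ ℂ) (H : ℝ) (X : ℂ → E3) : Submodule ℝ (ℂ → ℝ) :=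
  nullSpace Γ (potential H X)

/-- The nullity of the Jacobi operator: the multiplicity of its eigenvalue `0`. -/
def nullity (Γ : Submodule ℤ ℂ) (H : ℝ) (X : ℂ → E3) : Cardinal :=
  Module.rank ℝ (jacobiFields Γ H X)

/-- The vector field `p ↦ a + b × p` on `ℝ³`, generated by a one-parameter group of rigid
motions; these are exactly the fields generated in this way, each for one pair `(a, b)`. -/
def rigidField (a b p : E3) : E3 := a + WithLp.toLp 2 (b.ofLp ⨯₃ p.ofLp)

/-- The normal part `⟪v, ν⟫` along the surface of an infinitesimal rigid motion `v`. -/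
def rigidNormalPart (X ν : ℂ → E3) (a b : E3) (z : ℂ) : ℝ :=
  inner ℝ (rigidField a b (X z)) (ν z)

end Wente

end

/-!
The coordinates in which the Hopf differential is `dz²` are principal, with principal curvatures
`H ± 1 / E`. Hence `ν_x` and `ν_y` are multiples of `X_x` and `X_y`, and constancy of `H` gives
`Δ X = -2 H E ν` and `Δ ν = -V ν` (`laplacian_position`, `laplacian_normal`). For
`u = ⟪a + b × X, ν⟫` the product rule then leaves `Δ u = -V u`, because `v ↦ b × v` is skew
(`rigidNormalPart_mem_jacobiFields`).

If `u` vanishes identically, then `a + b × X = p X_x + q X_y` is a Killing field of the torus. In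
conformal coordinates `p + i q` is holomorphic, and being doubly periodic it is constant
(`exists_const_coeff_of_tangent`). Differentiating `u = 0` yields, for a sign `s = ±1`,
`⟪b, X_x⟫ = -s q (H E - 1)` and `⟪b, X_y⟫ = s p (H E + 1)`.
So `⟪b, X⟫` has constant derivative `2 s p q` in the direction `p + i q`, and `p q = 0`, as a
periodic function is bounded. The rest rests on the remark that a periodic function which is
invariant in one direction and monotone in another is constant (`fderiv_eq_zero_of_nonneg`):

* if `q = 0`, then `⟪b, X⟫` does not depend on `x`, and its `y`-derivative is `s p (H E + 1)`, so
  that `p = 0`;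
* if `p = 0`, then `s q ⟪b, ν - 2 H X⟫` does not depend on `y`, and its `x`-derivative is
  `q² (H E - 1)² / E`, so that `q (H E - 1) = 0`. Then `b` is orthogonal to all tangent planes, and
  `b = 0` since the curvature `H + 1 / E` is not zero. What remains is `a = q X_y`, and the
  periodic function `⟪a, X⟫` forces `q = 0`, that is, `a = 0`.

The second case plays the role of the fact that a Delaunay surface is never closed, without the
Gauss equation or the classification of these surfaces. The bound on the nullity follows, as
`(a, b) ↦ ⟪a + b × X, ν⟫` is linear and injective on a space of dimension six.
-/

namespace Wente

/-! ### Calculus on the parameter plane -/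

section Calculus

variable {G G' : Type*} [NormedAddCommGroup G] [NormedSpace ℝ G]
  [NormedAddCommGroup G'] [NormedSpace ℝ G']

lemma contDiff_fderiv_apply {f : ℂ → G} (hf : ContDiff ℝ ∞ f) (v : ℂ) :
    ContDiff ℝ ∞ fun z => fderiv ℝ f z v :=
  (hf.fderiv_right (m := ∞) (by simp)).clm_apply contDiff_const

lemma contDiff_dX {f : ℂ → G} (hf : ContDiff ℝ ∞ f) : ContDiff ℝ ∞ (dX f) :=
  contDiff_fderiv_apply hf 1

lemma contDiff_dY {f : ℂ → G} (hf : ContDiff ℝ ∞ f) : ContDiff ℝ ∞ (dY f) :=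
  contDiff_fderiv_apply hf Complex.I

lemma differentiable_of_smooth {f : ℂ → G} (hf : ContDiff ℝ ∞ f) : Differentiable ℝ f :=
  hf.differentiable (by simp)

lemma isPeriodic_fderiv {Γ : Submodule ℤ ℂ} {f : ℂ → G} (hf : IsPeriodic Γ f) :
    IsPeriodic Γ (fderiv ℝ f) := fun γ hγ z => by
  rw [← fderiv_comp_add_right]
  congr 1
  exact funext fun w => hf γ hγ w

lemma isPeriodic_dX {Γ : Submodule ℤ ℂ} {f : ℂ → G} (hf : IsPeriodic Γ f) :
    IsPeriodic Γ (dX f) := fun γ hγ z => by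
  simp only [dX, isPeriodic_fderiv hf γ hγ z]

lemma isPeriodic_dY {Γ : Submodule ℤ ℂ} {f : ℂ → G} (hf : IsPeriodic Γ f) :
    IsPeriodic Γ (dY f) := fun γ hγ z => by
  simp only [dY, isPeriodic_fderiv hf γ hγ z]

lemma fderiv_eq_dX_dY (f : ℂ → G) (z v : ℂ) :
    fderiv ℝ f z v = v.re • dX f z + v.im • dY f z := by
  have hv : v = v.re • (1 : ℂ) + v.im • Complex.I := by
    simp [Complex.re_add_im]
  conv_lhs => rw [hv]
  simp only [map_add, map_smul, dX, dY]

lemma dX_dY_comm {f : ℂ → G} (hf : ContDiff ℝ ∞ f) (z : ℂ) : dX (dY f) z = dY (dX f) z := by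
  have h : IsSymmSndFDerivAt ℝ f z := hf.contDiffAt.isSymmSndFDerivAt
    (by simpa using WithTop.coe_le_coe.2 (le_top : (2 : ℕ∞) ≤ ⊤))
  have hd : DifferentiableAt ℝ (fderiv ℝ f) z :=
    (hf.fderiv_right (m := ∞) (by simp)).differentiable (by simp) z
  have e (v w : ℂ) : fderiv ℝ (fun y => fderiv ℝ f y v) z w = fderiv ℝ (fderiv ℝ f) z w v := by
    rw [fderiv_clm_apply hd (differentiableAt_const v)]; simp
  change fderiv ℝ (fun y => fderiv ℝ f y Complex.I) z 1 =
    fderiv ℝ (fun y => fderiv ℝ f y 1) z Complex.I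
  rw [e, e, h]

lemma laplacian_eq_dX_dX_add_dY_dY {f : ℂ → G} (hf : ContDiff ℝ ∞ f) (z : ℂ) :
    Laplacian.laplacian f z = dX (dX f) z + dY (dY f) z := by
  have hd : DifferentiableAt ℝ (fderiv ℝ f) z :=
    (hf.fderiv_right (m := ∞) (by simp)).differentiable (by simp) z
  have e (v w : ℂ) : fderiv ℝ (fun y => fderiv ℝ f y v) z w = fderiv ℝ (fderiv ℝ f) z w v := by
    rw [fderiv_clm_apply hd (differentiableAt_const v)]; simp
  rw [InnerProductSpace.laplacian_eq_iteratedFDeriv_complexPlane]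
  simp only [iteratedFDeriv_two_apply]
  change _ = fderiv ℝ (fun y => fderiv ℝ f y 1) z 1 +
    fderiv ℝ (fun y => fderiv ℝ f y Complex.I) z Complex.I
  rw [e, e]; simp

lemma dX_add {f g : ℂ → G} (hf : ContDiff ℝ ∞ f) (hg : ContDiff ℝ ∞ g) (z : ℂ) :
    dX (fun w => f w + g w) z = dX f z + dX g z := by
  simp only [dX]
  rw [fderiv_fun_add (differentiable_of_smooth hf z) (differentiable_of_smooth hg z)]
  rfl

lemma dY_add {f g : ℂ → G} (hf : ContDiff ℝ ∞ f) (hg : ContDiff ℝ ∞ g) (z : ℂ) :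
    dY (fun w => f w + g w) z = dY f z + dY g z := by
  simp only [dY]
  rw [fderiv_fun_add (differentiable_of_smooth hf z) (differentiable_of_smooth hg z)]
  rfl

lemma dX_inner {f g : ℂ → E3} (hf : ContDiff ℝ ∞ f) (hg : ContDiff ℝ ∞ g) (z : ℂ) :
    dX (fun w => (inner ℝ (f w) (g w) : ℝ)) z =
      inner ℝ (dX f z) (g z) + inner ℝ (f z) (dX g z) := by
  rw [add_comm]
  exact fderiv_inner_apply ℝ (differentiable_of_smooth hf z) (differentiable_of_smooth hg z) 1

lemma dY_inner {f g : ℂ → E3} (hf : ContDiff ℝ ∞ f) (hg : ContDiff ℝ ∞ g) (z : ℂ) :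
    dY (fun w => (inner ℝ (f w) (g w) : ℝ)) z =
      inner ℝ (dY f z) (g z) + inner ℝ (f z) (dY g z) := by
  rw [add_comm]
  exact fderiv_inner_apply ℝ (differentiable_of_smooth hf z) (differentiable_of_smooth hg z) _

lemma dX_inner_eq_zero {f g : ℂ → E3} (hf : ContDiff ℝ ∞ f) (hg : ContDiff ℝ ∞ g) {c : ℝ}
    (h : ∀ z, inner ℝ (f z) (g z) = c) (z : ℂ) :
    inner ℝ (dX f z) (g z) + inner ℝ (f z) (dX g z) = 0 := by
  rw [← dX_inner hf hg, funext h]; simp [dX]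

lemma dY_inner_eq_zero {f g : ℂ → E3} (hf : ContDiff ℝ ∞ f) (hg : ContDiff ℝ ∞ g) {c : ℝ}
    (h : ∀ z, inner ℝ (f z) (g z) = c) (z : ℂ) :
    inner ℝ (dY f z) (g z) + inner ℝ (f z) (dY g z) = 0 := by
  rw [← dY_inner hf hg, funext h]; simp [dY]

lemma fderiv_const_add_clm_comp (a : G') (B : G →L[ℝ] G') {f : ℂ → G} (hf : ContDiff ℝ ∞ f)
    (z v : ℂ) : fderiv ℝ (fun w => a + B (f w)) z v = B (fderiv ℝ f z v) := by
  have := (B.hasFDerivAt.comp z (differentiable_of_smooth hf z).hasFDerivAt).const_add a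
  have e := this.fderiv
  exact DFunLike.congr_fun e v

lemma dX_const_add_clm_comp (a : G') (B : G →L[ℝ] G') {f : ℂ → G} (hf : ContDiff ℝ ∞ f) :
    dX (fun w => a + B (f w)) = fun w => B (dX f w) :=
  funext fun z => fderiv_const_add_clm_comp a B hf z 1

lemma dY_const_add_clm_comp (a : G') (B : G →L[ℝ] G') {f : ℂ → G} (hf : ContDiff ℝ ∞ f) :
    dY (fun w => a + B (f w)) = fun w => B (dY f w) :=
  funext fun z => fderiv_const_add_clm_comp a B hf z Complex.I

lemma dX_clm_comp (B : G →L[ℝ] G') {f : ℂ → G} (hf : ContDiff ℝ ∞ f) :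
    dX (fun w => B (f w)) = fun w => B (dX f w) := by
  simpa using dX_const_add_clm_comp 0 B hf

lemma dY_clm_comp (B : G →L[ℝ] G') {f : ℂ → G} (hf : ContDiff ℝ ∞ f) :
    dY (fun w => B (f w)) = fun w => B (dY f w) := by
  simpa using dY_const_add_clm_comp 0 B hf

end Calculus

/-! ### Periodic functions on the plane -/

section Periodic

variable {Γ : Submodule ℤ ℂ}

lemma isBounded_range_of_isPeriodic [DiscreteTopology Γ] [IsZLattice ℝ Γ]
    {G : Type*} [NormedAddCommGroup G] {f : ℂ → G}
    (hp : IsPeriodic Γ f) (hf : Continuous f) : Bornology.IsBounded (Set.range f) :=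
  (IsZLattice.isCompact_range_of_periodic Γ f hf fun z w hw => hp w hw z).isBounded

lemma hasDerivAt_comp_line {f : ℂ → ℝ} (hf : Differentiable ℝ f) (z v : ℂ) (t : ℝ) :
    HasDerivAt (fun s : ℝ => f (z + s • v)) (fderiv ℝ f (z + t • v) v) t := by
  have h : HasDerivAt (fun s : ℝ => z + s • v) v t := by
    simpa using ((hasDerivAt_id t).smul_const v).const_add z
  exact (hf _).hasFDerivAt.comp_hasDerivAt t h

lemma add_smul_eq_of_fderiv_eq_zero {f : ℂ → ℝ} (hf : Differentiable ℝ f) {v : ℂ}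
    (hv : ∀ z, fderiv ℝ f z v = 0) (z : ℂ) (t : ℝ) : f (z + t • v) = f z := by
  have := is_const_of_deriv_eq_zero (f := fun s : ℝ => f (z + s • v))
    (fun s => (hasDerivAt_comp_line hf z v s).differentiableAt)
    (fun s => by rw [(hasDerivAt_comp_line hf z v s).deriv, hv]) t 0
  simpa using this

/-- A periodic function whose derivative in some direction is constant has derivative zero in
that direction, as it would otherwise be unbounded. -/
lemma eq_zero_of_fderiv_const [DiscreteTopology Γ] [IsZLattice ℝ Γ]
    {f : ℂ → ℝ} (hp : IsPeriodic Γ f)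
    (hf : Differentiable ℝ f) {v : ℂ} {c : ℝ} (hc : ∀ z, fderiv ℝ f z v = c) : c = 0 := by
  obtain ⟨C, hC⟩ := (isBounded_range_of_isPeriodic hp hf.continuous).exists_norm_le
  have hlin (t : ℝ) : f (t • v) = f 0 + c * t := by
    have hd (s : ℝ) : HasDerivAt (fun s : ℝ => f (0 + s • v) - c * s) 0 s := by
      have := (hasDerivAt_comp_line hf 0 v s).fun_sub ((hasDerivAt_id s).const_mul c)
      simpa only [hc, mul_one, sub_self, id_eq] using this
    have h := is_const_of_deriv_eq_zero (fun s => (hd s).differentiableAt)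
      (fun s => (hd s).deriv) t 0
    simp only [zero_add, zero_smul, mul_zero, sub_zero] at h
    linarith
  by_contra h0
  have h1 := hC (f (((2 * C + 1) / c) • v)) ⟨_, rfl⟩
  have h2 := hC (f 0) ⟨_, rfl⟩
  rw [hlin, mul_div_cancel₀ _ h0] at h1
  rw [Real.norm_eq_abs, abs_le] at h1 h2
  linarith

lemma linearIndependent_one_I : LinearIndependent ℝ ![(1 : ℂ), Complex.I] := by
  rw [LinearIndependent.pair_iff]
  intro s t h
  exact ⟨by simpa using congrArg Complex.re h, by simpa using congrArg Complex.im h⟩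

lemma linearIndependent_I_one : LinearIndependent ℝ ![Complex.I, (1 : ℂ)] := by
  rw [LinearIndependent.pair_iff]
  intro s t h
  exact ⟨by simpa using congrArg Complex.im h, by simpa using congrArg Complex.re h⟩

/-- If a periodic function is invariant in the direction `v` and monotone in an independent
direction `w`, then it is constant: some period is not a multiple of `v`, and it acts as a
translation in the direction `w`. -/
lemma fderiv_eq_zero_of_nonneg [DiscreteTopology Γ] [IsZLattice ℝ Γ] {f : ℂ → ℝ}
    (hp : IsPeriodic Γ f) (hf : Differentiable ℝ f) {v w : ℂ} (hvw : LinearIndependent ℝ ![v, w])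
    (hv : ∀ z, fderiv ℝ f z v = 0) (hw : ∀ z, 0 ≤ fderiv ℝ f z w) (z : ℂ) :
    fderiv ℝ f z w = 0 := by
  have hspan : Submodule.span ℝ (Set.range ![v, w]) = ⊤ :=
    hvw.span_eq_top_of_card_eq_finrank (by simp [Complex.finrank_real_complex])
  have hcoord (ζ : ℂ) : ∃ s t : ℝ, s • v + t • w = ζ := by
    have : ζ ∈ Submodule.span ℝ (Set.range ![v, w]) := hspan ▸ Submodule.mem_top
    obtain ⟨t, s, h⟩ : ∃ t s : ℝ, t • w + s • v = ζ := by
      simpa [Submodule.mem_span_pair] using this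
    exact ⟨s, t, by rw [add_comm, h]⟩
  obtain ⟨s, t, ht, hγ⟩ : ∃ s t : ℝ, t ≠ 0 ∧ s • v + t • w ∈ Γ := by
    by_contra! hcon
    have hle : Submodule.span ℝ (Γ : Set ℂ) ≤ Submodule.span ℝ {v} := by
      refine Submodule.span_le.2 fun γ hγ => ?_
      obtain ⟨s, t, rfl⟩ := hcoord γ
      have ht : t = 0 := by
        by_contra ht
        exact hcon s t ht hγ
      simpa [ht] using Submodule.smul_mem _ s (Submodule.mem_span_singleton_self v)
    rw [IsZLattice.span_top] at hle
    obtain ⟨c, hc⟩ := Submodule.mem_span_singleton.1 (hle (Submodule.mem_top (x := w)))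
    have := (LinearIndependent.pair_iff.1 hvw) c (-1) (by simp [hc])
    norm_num at this
  have hshift (r : ℝ) : f (z + (r + t) • w) = f (z + r • w) := by
    rw [← hp _ hγ (z + r • w), ← add_smul_eq_of_fderiv_eq_zero hf hv _ s]
    congr 1
    module
  set φ : ℝ → ℝ := fun r => f (z + r • w) with hφ
  have hmono : Monotone φ := monotone_of_deriv_nonneg
    (fun r => (hasDerivAt_comp_line hf z w r).differentiableAt)
    (fun r => by rw [(hasDerivAt_comp_line hf z w r).deriv]; exact hw _)
  have hper : Function.Periodic φ t := hshift
  have hconst (r : ℝ) : φ r = φ 0 := by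
    obtain ⟨n, hn⟩ := exists_nat_ge (|r / t|)
    have hn' : |r| ≤ n * |t| := by
      rw [abs_div, div_le_iff₀ (abs_pos.2 ht)] at hn
      exact hn
    have hup : φ (n * |t|) = φ 0 := by
      rcases abs_choice t with h | h <;> rw [h]
      · simpa using hper.nat_mul n 0
      · simpa using hper.neg.nat_mul n 0
    have hdn : φ (-(n * |t|)) = φ 0 := by
      rcases abs_choice t with h | h <;> rw [h]
      · simpa using hper.neg.nat_mul n 0
      · simpa using hper.nat_mul n 0
    exact le_antisymm (hup ▸ hmono (abs_le.1 hn').2) (hdn ▸ hmono (abs_le.1 hn').1)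
  have h1 := hasDerivAt_comp_line hf z w 0
  have h2 : HasDerivAt φ 0 0 := by
    rw [show φ = fun _ => φ 0 from funext hconst]
    exact hasDerivAt_const _ _
  simpa using h1.unique h2

/-- A smooth periodic solution `(p, q)` of the Cauchy–Riemann equations is constant, by
Liouville's theorem. -/
lemma const_of_cauchyRiemann [DiscreteTopology Γ] [IsZLattice ℝ Γ]
    {p q : ℂ → ℝ} (hp : Differentiable ℝ p) (hq : Differentiable ℝ q)
    (pp : IsPeriodic Γ p) (pq : IsPeriodic Γ q) (h1 : ∀ z, dX p z = dY q z)
    (h2 : ∀ z, dY p z = -dX q z) (z : ℂ) : p z = p 0 ∧ q z = q 0 := by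
  set f : ℂ → ℂ := fun z => p z • (1 : ℂ) + q z • Complex.I with hf
  have hd (z : ℂ) : HasFDerivAt f ((fderiv ℝ p z).smulRight (1 : ℂ)
      + (fderiv ℝ q z).smulRight Complex.I) z :=
    ((hp z).hasFDerivAt.smul_const (1 : ℂ)).add ((hq z).hasFDerivAt.smul_const Complex.I)
  have hfd : Differentiable ℂ f := fun z => by
    refine differentiableAt_complex_iff_differentiableAt_real.2 ⟨(hd z).differentiableAt, ?_⟩
    rw [(hd z).fderiv]
    have e1 := h1 z
    have e2 := h2 z
    simp only [dX, dY] at e1 e2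
    apply Complex.ext <;> simp [e1, e2]
  have hfp : IsPeriodic Γ f := fun γ hγ z => by simp only [hf, pp γ hγ z, pq γ hγ z]
  have := hfd.apply_eq_apply_of_bounded (isBounded_range_of_isPeriodic hfp hfd.continuous) z 0
  constructor
  · simpa [hf] using congrArg Complex.re this
  · simpa [hf] using congrArg Complex.im this

end Periodic

/-! ### The cross product on Euclidean three-space -/

/-- The cross product `v ↦ b × v` as a continuous linear endomorphism of Euclidean
three-space. -/
noncomputable def crossCLM (b : E3) : E3 →L[ℝ] E3 :=
  LinearMap.toContinuousLinearMap
    ((WithLp.linearEquiv 2 ℝ (Fin 3 → ℝ)).symm.toLinearMap ∘ₗ crossProduct b.ofLp ∘ₗ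
      (WithLp.linearEquiv 2 ℝ (Fin 3 → ℝ)).toLinearMap)

lemma rigidField_eq (a b p : E3) : rigidField a b p = a + crossCLM b p := rfl

lemma crossCLM_apply (b v : E3) :
    crossCLM b v = !₂[b 1 * v 2 - b 2 * v 1, b 2 * v 0 - b 0 * v 2, b 0 * v 1 - b 1 * v 0] :=
  congrArg (WithLp.toLp 2) (cross_apply b.ofLp v.ofLp)

lemma crossCLM_zero_left (v : E3) : crossCLM 0 v = 0 := by
  rw [crossCLM_apply]; ext i; fin_cases i <;> simp

lemma inner_eq_sum (v w : E3) : inner ℝ v w = v 0 * w 0 + v 1 * w 1 + v 2 * w 2 := by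
  simp [PiLp.inner_apply, Fin.sum_univ_three, mul_comm]

lemma inner_crossCLM_self (b v : E3) : inner ℝ (crossCLM b v) v = 0 := by
  simp [inner_eq_sum, crossCLM_apply]; ring

lemma inner_crossCLM_left (b v : E3) : inner ℝ (crossCLM b v) b = 0 := by
  simp [inner_eq_sum, crossCLM_apply]; ring

lemma inner_crossCLM_swap (b v w : E3) :
    inner ℝ (crossCLM b v) w = -inner ℝ (crossCLM b w) v := by
  simp [inner_eq_sum, crossCLM_apply]; ring

lemma inner_crossCLM_rotate (b v w : E3) :
    inner ℝ (crossCLM b v) w = inner ℝ (crossCLM v w) b := by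
  simp [inner_eq_sum, crossCLM_apply]; ring

lemma inner_crossCLM_crossCLM (b v : E3) :
    inner ℝ (crossCLM b v) (crossCLM b v) = inner ℝ b b * inner ℝ v v - (inner ℝ b v) ^ 2 := by
  simp only [inner_eq_sum, crossCLM_apply]; simp; ring

/-- Two vectors agree if they have the same inner products with three nonzero pairwise
orthogonal vectors. -/
lemma eq_of_inner_orthogonal {e₁ e₂ e₃ : E3} (h₁ : e₁ ≠ 0) (h₂ : e₂ ≠ 0) (h₃ : e₃ ≠ 0)
    (h₁₂ : inner ℝ e₁ e₂ = 0) (h₁₃ : inner ℝ e₁ e₃ = 0) (h₂₃ : inner ℝ e₂ e₃ = 0) {v w : E3}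
    (k₁ : inner ℝ v e₁ = inner ℝ w e₁) (k₂ : inner ℝ v e₂ = inner ℝ w e₂)
    (k₃ : inner ℝ v e₃ = inner ℝ w e₃) : v = w := by
  have hli : LinearIndependent ℝ ![e₁, e₂, e₃] := by
    refine linearIndependent_of_ne_zero_of_inner_eq_zero (𝕜 := ℝ) ?_ ?_
    · intro i; fin_cases i <;> simpa
    · intro i j hij
      fin_cases i <;> fin_cases j <;>
        first
        | exact absurd rfl hij
        | simpa
        | simpa [real_inner_comm] using h₁₂
        | simpa [real_inner_comm] using h₁₃
        | simpa [real_inner_comm] using h₂₃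
  let B := basisOfLinearIndependentOfCardEqFinrank hli (by simp)
  refine InnerProductSpace.ext_inner_right_basis B fun i => ?_
  fin_cases i <;> simpa [B]

/-! ### The structure equations of a surface with Hopf differential `dz²` -/

namespace IsSymmetricWenteTorus

variable {Γ : Submodule ℤ ℂ} {H : ℝ} {X ν : ℂ → E3}

lemma dX_ne_zero (hW : IsSymmetricWenteTorus Γ H X ν) (z : ℂ) : dX X z ≠ 0 := fun h =>
  one_ne_zero (hW.immersion z (h.trans (map_zero _).symm))

lemma dY_ne_zero (hW : IsSymmetricWenteTorus Γ H X ν) (z : ℂ) : dY X z ≠ 0 := fun h =>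
  Complex.I_ne_zero (hW.immersion z (h.trans (map_zero _).symm))

lemma normal_ne_zero (hW : IsSymmetricWenteTorus Γ H X ν) (z : ℂ) : ν z ≠ 0 := fun h => by
  simpa [h] using hW.unit_normal z

lemma inner_normal_self (hW : IsSymmetricWenteTorus Γ H X ν) (z : ℂ) :
    inner ℝ (ν z) (ν z) = 1 := by
  rw [real_inner_self_eq_norm_sq, hW.unit_normal]; norm_num

lemma metricE_pos (hW : IsSymmetricWenteTorus Γ H X ν) (z : ℂ) : 0 < metricE X z :=
  real_inner_self_pos.2 (hW.dX_ne_zero z)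

lemma inner_dX_dX (z : ℂ) : inner ℝ (dX X z) (dX X z) = metricE X z := rfl

lemma inner_dY_dY (hW : IsSymmetricWenteTorus Γ H X ν) (z : ℂ) :
    inner ℝ (dY X z) (dY X z) = metricE X z := (hW.conformal_norm z).symm

lemma inner_dY_dX (hW : IsSymmetricWenteTorus Γ H X ν) (z : ℂ) :
    inner ℝ (dY X z) (dX X z) = 0 := (real_inner_comm _ _).trans (hW.conformal_angle z)

lemma inner_normal_dX (hW : IsSymmetricWenteTorus Γ H X ν) (z : ℂ) :
    inner ℝ (ν z) (dX X z) = 0 := (real_inner_comm _ _).trans (hW.normal_dX z)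

lemma inner_normal_dY (hW : IsSymmetricWenteTorus Γ H X ν) (z : ℂ) :
    inner ℝ (ν z) (dY X z) = 0 := (real_inner_comm _ _).trans (hW.normal_dY z)

lemma contDiff_metricE (hW : IsSymmetricWenteTorus Γ H X ν) : ContDiff ℝ ∞ (metricE X) :=
  (contDiff_dX hW.smooth).inner ℝ (contDiff_dX hW.smooth)

lemma ext_frame (hW : IsSymmetricWenteTorus Γ H X ν) (z : ℂ) {v w : E3}
    (hx : inner ℝ v (dX X z) = inner ℝ w (dX X z)) (hy : inner ℝ v (dY X z) = inner ℝ w (dY X z))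
    (hn : inner ℝ v (ν z) = inner ℝ w (ν z)) : v = w :=
  eq_of_inner_orthogonal (hW.dX_ne_zero z) (hW.dY_ne_zero z) (hW.normal_ne_zero z)
    (hW.conformal_angle z) (hW.normal_dX z) (hW.normal_dY z) hx hy hn

lemma sffM_eq_zero (hW : IsSymmetricWenteTorus Γ H X ν) (z : ℂ) : sffM X ν z = 0 := by
  simpa [hopf] using congrArg Complex.im (hW.hopf_eq_one z)

lemma sffL_eq (hW : IsSymmetricWenteTorus Γ H X ν) (z : ℂ) :
    sffL X ν z = H * metricE X z + 1 := by
  have h1 : (sffL X ν z - sffN X ν z) / 2 = 1 := by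
    simpa [hopf] using congrArg Complex.re (hW.hopf_eq_one z)
  have h2 := hW.cmc z
  have h3 := hW.metricE_pos z
  rw [meanCurvature, div_eq_iff (by positivity)] at h2
  linarith

lemma sffN_eq (hW : IsSymmetricWenteTorus Γ H X ν) (z : ℂ) :
    sffN X ν z = H * metricE X z - 1 := by
  have h1 : (sffL X ν z - sffN X ν z) / 2 = 1 := by
    simpa [hopf] using congrArg Complex.re (hW.hopf_eq_one z)
  have h2 := hW.sffL_eq z
  linarith

/-- The Weingarten equation in the direction of `x`: the `x`-lines are principal curves, with
principal curvature `H + 1 / E`. -/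
lemma dX_normal (hW : IsSymmetricWenteTorus Γ H X ν) (z : ℂ) :
    dX ν z = ((H * metricE X z + 1) / metricE X z) • dX X z := by
  have hE := (hW.metricE_pos z).ne'
  have sx := contDiff_dX hW.smooth
  have sy := contDiff_dY hW.smooth
  have sν := hW.smooth_normal
  apply hW.ext_frame z
  · have h1 := dX_inner_eq_zero sx sν hW.normal_dX z
    have h2 := hW.sffL_eq z
    rw [sffL] at h2
    rw [real_inner_smul_left, inner_dX_dX, div_mul_cancel₀ _ hE, real_inner_comm]
    linarith
  · have h1 := dX_inner_eq_zero sy sν hW.normal_dY z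
    have h2 := hW.sffM_eq_zero z
    rw [sffM, ← dX_dY_comm hW.smooth] at h2
    rw [real_inner_smul_left, hW.conformal_angle, real_inner_comm]
    linarith
  · have h1 := dX_inner_eq_zero sν sν hW.inner_normal_self z
    rw [real_inner_comm (dX ν z)] at h1
    rw [real_inner_smul_left, hW.normal_dX]
    linarith

/-- The Weingarten equation in the direction of `y`: the `y`-lines are principal curves, with
principal curvature `H - 1 / E`. -/
lemma dY_normal (hW : IsSymmetricWenteTorus Γ H X ν) (z : ℂ) :
    dY ν z = ((H * metricE X z - 1) / metricE X z) • dY X z := by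
  have hE := (hW.metricE_pos z).ne'
  have sx := contDiff_dX hW.smooth
  have sy := contDiff_dY hW.smooth
  have sν := hW.smooth_normal
  apply hW.ext_frame z
  · have h1 := dY_inner_eq_zero sx sν hW.normal_dX z
    have h2 := hW.sffM_eq_zero z
    rw [sffM] at h2
    rw [real_inner_smul_left, hW.inner_dY_dX, real_inner_comm]
    linarith
  · have h1 := dY_inner_eq_zero sy sν hW.normal_dY z
    have h2 := hW.sffN_eq z
    rw [sffN] at h2
    rw [real_inner_smul_left, hW.inner_dY_dY, div_mul_cancel₀ _ hE, real_inner_comm]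
    linarith
  · have h1 := dY_inner_eq_zero sν sν hW.inner_normal_self z
    rw [real_inner_comm (dY ν z)] at h1
    rw [real_inner_smul_left, hW.normal_dY]
    linarith

/-! ### Tangential parts of the second derivatives, and the Laplacians of `X` and `ν` -/

lemma inner_dXdX_dX (hW : IsSymmetricWenteTorus Γ H X ν) (z : ℂ) :
    inner ℝ (dX (dX X) z) (dX X z) = dX (metricE X) z / 2 := by
  have := dX_inner (contDiff_dX hW.smooth) (contDiff_dX hW.smooth) z
  rw [real_inner_comm (dX (dX X) z)] at this
  change dX (metricE X) z = _ at this
  linarith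

lemma inner_dYdX_dX (hW : IsSymmetricWenteTorus Γ H X ν) (z : ℂ) :
    inner ℝ (dY (dX X) z) (dX X z) = dY (metricE X) z / 2 := by
  have := dY_inner (contDiff_dX hW.smooth) (contDiff_dX hW.smooth) z
  rw [real_inner_comm (dY (dX X) z)] at this
  change dY (metricE X) z = _ at this
  linarith

lemma inner_dYdX_dY (hW : IsSymmetricWenteTorus Γ H X ν) (z : ℂ) :
    inner ℝ (dY (dX X) z) (dY X z) = dX (metricE X) z / 2 := by
  have := dX_inner (contDiff_dY hW.smooth) (contDiff_dY hW.smooth) z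
  rw [real_inner_comm (dX (dY X) z), funext hW.inner_dY_dY, dX_dY_comm hW.smooth] at this
  linarith

lemma inner_dYdY_dY (hW : IsSymmetricWenteTorus Γ H X ν) (z : ℂ) :
    inner ℝ (dY (dY X) z) (dY X z) = dY (metricE X) z / 2 := by
  have := dY_inner (contDiff_dY hW.smooth) (contDiff_dY hW.smooth) z
  rw [real_inner_comm (dY (dY X) z), funext hW.inner_dY_dY] at this
  linarith

lemma inner_dXdX_dY (hW : IsSymmetricWenteTorus Γ H X ν) (z : ℂ) :
    inner ℝ (dX (dX X) z) (dY X z) = -dY (metricE X) z / 2 := by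
  have := dX_inner_eq_zero (contDiff_dX hW.smooth) (contDiff_dY hW.smooth) hW.conformal_angle z
  rw [dX_dY_comm hW.smooth, real_inner_comm _ (dX X z), hW.inner_dYdX_dX] at this
  linarith

lemma inner_dYdY_dX (hW : IsSymmetricWenteTorus Γ H X ν) (z : ℂ) :
    inner ℝ (dY (dY X) z) (dX X z) = -dX (metricE X) z / 2 := by
  have := dY_inner_eq_zero (contDiff_dX hW.smooth) (contDiff_dY hW.smooth) hW.conformal_angle z
  rw [hW.inner_dYdX_dY, real_inner_comm] at this
  linarith

/-- `Δ X = -2 H E ν`. -/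
lemma laplacian_position (hW : IsSymmetricWenteTorus Γ H X ν) (z : ℂ) :
    dX (dX X) z + dY (dY X) z = (-(2 * H * metricE X z)) • ν z := by
  apply hW.ext_frame z
  · rw [inner_add_left, hW.inner_dXdX_dX, hW.inner_dYdY_dX, real_inner_smul_left,
      hW.inner_normal_dX]
    ring
  · rw [inner_add_left, hW.inner_dXdX_dY, hW.inner_dYdY_dY, real_inner_smul_left,
      hW.inner_normal_dY]
    ring
  · have h1 := hW.sffL_eq z
    have h2 := hW.sffN_eq z
    rw [sffL] at h1
    rw [sffN] at h2
    rw [inner_add_left, real_inner_smul_left, hW.inner_normal_self]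
    linarith

lemma potential_eq (hW : IsSymmetricWenteTorus Γ H X ν) (z : ℂ) :
    potential H X z = 2 * (H ^ 2 * metricE X z + 1 / metricE X z) := by
  have hE := hW.metricE_pos z
  have hH := hW.pos
  rw [potential, logMetric, Real.cosh_log (by positivity)]
  field_simp
  ring

/-- `Δ ν = -V ν`: the Gauss map of a surface of constant mean curvature is harmonic, and `V` is
its energy density. -/
lemma laplacian_normal (hW : IsSymmetricWenteTorus Γ H X ν) (z : ℂ) :
    dX (dX ν) z + dY (dY ν) z = (-potential H X z) • ν z := by
  have hE := (hW.metricE_pos z).ne'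
  have sx := contDiff_dX hW.smooth
  have sy := contDiff_dY hW.smooth
  have sν := hW.smooth_normal
  have snx := contDiff_dX sν
  have sny := contDiff_dY sν
  have dE := differentiable_of_smooth hW.contDiff_metricE z
  have exx (w : ℂ) : inner ℝ (dX ν w) (dX X w) = H * metricE X w + 1 := by
    rw [hW.dX_normal, real_inner_smul_left, inner_dX_dX,
      div_mul_cancel₀ _ (hW.metricE_pos w).ne']
  have eyy (w : ℂ) : inner ℝ (dY ν w) (dY X w) = H * metricE X w - 1 := by
    rw [hW.dY_normal, real_inner_smul_left, hW.inner_dY_dY,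
      div_mul_cancel₀ _ (hW.metricE_pos w).ne']
  have exy (w : ℂ) : inner ℝ (dX ν w) (dY X w) = 0 := by
    rw [hW.dX_normal, real_inner_smul_left, hW.conformal_angle, mul_zero]
  have eyx (w : ℂ) : inner ℝ (dY ν w) (dX X w) = 0 := by
    rw [hW.dY_normal, real_inner_smul_left, hW.inner_dY_dX, mul_zero]
  have exn (w : ℂ) : inner ℝ (dX ν w) (ν w) = 0 := by
    rw [hW.dX_normal, real_inner_smul_left, hW.normal_dX, mul_zero]
  have eyn (w : ℂ) : inner ℝ (dY ν w) (ν w) = 0 := by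
    rw [hW.dY_normal, real_inner_smul_left, hW.normal_dY, mul_zero]
  have dL : dX (fun w => H * metricE X w + 1) z = H * dX (metricE X) z := by
    simp only [dX]; rw [fderiv_add_const, fderiv_const_mul dE]; rfl
  have dN : dY (fun w => H * metricE X w - 1) z = H * dY (metricE X) z := by
    simp only [dY]; rw [fderiv_sub_const, fderiv_const_mul dE]; rfl
  apply hW.ext_frame z
  · have h1 := dX_inner snx sx z
    have h2 := dY_inner_eq_zero sny sx eyx z
    rw [funext exx, dL, hW.dX_normal, real_inner_smul_left, real_inner_comm _ (dX X z),
      hW.inner_dXdX_dX] at h1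
    rw [hW.dY_normal, real_inner_smul_left, real_inner_comm _ (dY X z), hW.inner_dYdX_dY] at h2
    rw [inner_add_left, real_inner_smul_left, hW.inner_normal_dX, eq_sub_of_add_eq h1.symm,
      eq_neg_of_add_eq_zero_left h2]
    field_simp
    ring
  · have h1 := dX_inner_eq_zero snx sy exy z
    have h2 := dY_inner sny sy z
    rw [funext eyy, dN, hW.dY_normal, real_inner_smul_left, real_inner_comm _ (dY X z),
      hW.inner_dYdY_dY] at h2
    rw [hW.dX_normal, real_inner_smul_left, dX_dY_comm hW.smooth, real_inner_comm _ (dX X z),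
      hW.inner_dYdX_dX] at h1
    rw [inner_add_left, real_inner_smul_left, hW.inner_normal_dY, eq_sub_of_add_eq h2.symm,
      eq_neg_of_add_eq_zero_left h1]
    field_simp
    ring
  · have h1 := dX_inner_eq_zero snx sν exn z
    have h2 := dY_inner_eq_zero sny sν eyn z
    rw [hW.dX_normal, real_inner_smul_left, real_inner_smul_right, inner_dX_dX] at h1
    rw [hW.dY_normal, real_inner_smul_left, real_inner_smul_right, hW.inner_dY_dY] at h2
    rw [inner_add_left, real_inner_smul_left, hW.inner_normal_self, hW.potential_eq,
      eq_neg_of_add_eq_zero_left h1, eq_neg_of_add_eq_zero_left h2]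
    field_simp
    ring

/-! ### Infinitesimal rigid motions give Jacobi fields -/

lemma contDiff_rigidField (hW : IsSymmetricWenteTorus Γ H X ν) (a b : E3) :
    ContDiff ℝ ∞ fun z => rigidField a b (X z) := by
  simp only [rigidField_eq]
  exact contDiff_const.add ((crossCLM b).contDiff.comp hW.smooth)

/-- Along the surface, `Δ ⟪a + B X, ν⟫ = ⟪B ΔX, ν⟫ + 2 (⟪B X_x, ν_x⟫ + ⟪B X_y, ν_y⟫)
+ ⟪a + B X, Δν⟫` with `B = b × ·` skew. The first summand vanishes as `ΔX` is normal, the second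
one as `ν_x` and `ν_y` are multiples of `X_x` and `X_y`; the last one is `-V ⟪a + B X, ν⟫`. -/
lemma rigidNormalPart_mem_jacobiFields (hW : IsSymmetricWenteTorus Γ H X ν) (a b : E3) :
    rigidNormalPart X ν a b ∈ jacobiFields Γ H X := by
  have sT := hW.contDiff_rigidField a b
  have sν := hW.smooth_normal
  have sx := contDiff_dX hW.smooth
  have sy := contDiff_dY hW.smooth
  have su : ContDiff ℝ ∞ (rigidNormalPart X ν a b) := sT.inner ℝ sν
  have sBx : ContDiff ℝ ∞ fun w => crossCLM b (dX X w) := (crossCLM b).contDiff.comp sx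
  have sBy : ContDiff ℝ ∞ fun w => crossCLM b (dY X w) := (crossCLM b).contDiff.comp sy
  have dTx : dX (fun w => rigidField a b (X w)) = fun w => crossCLM b (dX X w) :=
    dX_const_add_clm_comp a (crossCLM b) hW.smooth
  have dTy : dY (fun w => rigidField a b (X w)) = fun w => crossCLM b (dY X w) :=
    dY_const_add_clm_comp a (crossCLM b) hW.smooth
  refine ⟨su, fun γ hγ z => ?_, fun z => ?_⟩
  · simp only [rigidNormalPart, hW.periodic γ hγ z, hW.periodic_normal γ hγ z]
  · have ux : dX (rigidNormalPart X ν a b) = fun w =>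
        inner ℝ (crossCLM b (dX X w)) (ν w) + inner ℝ (rigidField a b (X w)) (dX ν w) :=
      funext fun w => by rw [← congrFun dTx w]; exact dX_inner sT sν w
    have uy : dY (rigidNormalPart X ν a b) = fun w =>
        inner ℝ (crossCLM b (dY X w)) (ν w) + inner ℝ (rigidField a b (X w)) (dY ν w) :=
      funext fun w => by rw [← congrFun dTy w]; exact dY_inner sT sν w
    have uxx : dX (dX (rigidNormalPart X ν a b)) z =
        inner ℝ (crossCLM b (dX (dX X) z)) (ν z)
          + inner ℝ (rigidField a b (X z)) (dX (dX ν) z) := by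
      have e1 := dX_inner sBx sν z
      have e2 := dX_inner sT (contDiff_dX sν) z
      rw [dX_clm_comp _ sx] at e1
      rw [dTx] at e2
      rw [hW.dX_normal, real_inner_smul_right, inner_crossCLM_self, mul_zero] at e1 e2
      rw [ux, dX_add (sBx.inner ℝ sν) (sT.inner ℝ (contDiff_dX sν)), e1, e2, add_zero,
        zero_add]
    have uyy : dY (dY (rigidNormalPart X ν a b)) z =
        inner ℝ (crossCLM b (dY (dY X) z)) (ν z)
          + inner ℝ (rigidField a b (X z)) (dY (dY ν) z) := by
      have e1 := dY_inner sBy sν z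
      have e2 := dY_inner sT (contDiff_dY sν) z
      rw [dY_clm_comp _ sy] at e1
      rw [dTy] at e2
      rw [hW.dY_normal, real_inner_smul_right, inner_crossCLM_self, mul_zero] at e1 e2
      rw [uy, dY_add (sBy.inner ℝ sν) (sT.inner ℝ (contDiff_dY sν)), e1, e2, add_zero,
        zero_add]
    have hX : inner ℝ (crossCLM b (dX (dX X) z)) (ν z)
        + inner ℝ (crossCLM b (dY (dY X) z)) (ν z) = 0 := by
      rw [← inner_add_left, ← map_add, hW.laplacian_position, map_smul, real_inner_smul_left,
        inner_crossCLM_self, mul_zero]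
    have hν : inner ℝ (rigidField a b (X z)) (dX (dX ν) z)
        + inner ℝ (rigidField a b (X z)) (dY (dY ν) z)
        = -potential H X z * rigidNormalPart X ν a b z := by
      rw [← inner_add_right, hW.laplacian_normal, real_inner_smul_right]; rfl
    rw [schrodinger, laplacian_eq_dX_dX_add_dY_dY su, uxx, uyy]
    linarith

/-! ### Tangential infinitesimal rigid motions -/

/-- With respect to a conformal orthogonal frame of a connected surface, the normal has a constant
orientation sign `s`; it is recorded through `X_x × ν = -s X_y` and `X_y × ν = s X_x`. -/
lemma exists_orientation (hW : IsSymmetricWenteTorus Γ H X ν) :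
    ∃ s : ℝ, s * s = 1 ∧ ∀ z, crossCLM (dX X z) (ν z) = (-s) • dY X z ∧
      crossCLM (dY X z) (ν z) = s • dX X z := by
  have sx := contDiff_dX hW.smooth
  have sy := contDiff_dY hW.smooth
  -- `t` is the triple product of the frame; it is `E` up to a sign, which is locally constant.
  set t : ℂ → ℝ := fun z => inner ℝ (crossCLM (dY X z) (ν z)) (dX X z) with ht
  have hy (z : ℂ) : crossCLM (dY X z) (ν z) = (t z / metricE X z) • dX X z := by
    have hE := (hW.metricE_pos z).ne'
    apply hW.ext_frame z
    · rw [real_inner_smul_left, inner_dX_dX, div_mul_cancel₀ _ hE]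
    · rw [real_inner_smul_left, hW.conformal_angle, inner_crossCLM_left, mul_zero]
    · rw [real_inner_smul_left, hW.normal_dX, inner_crossCLM_self, mul_zero]
  have hx (z : ℂ) : crossCLM (dX X z) (ν z) = (-(t z / metricE X z)) • dY X z := by
    have hE := (hW.metricE_pos z).ne'
    apply hW.ext_frame z
    · rw [real_inner_smul_left, hW.inner_dY_dX, inner_crossCLM_left, mul_zero]
    · rw [real_inner_smul_left, hW.inner_dY_dY, neg_mul, div_mul_cancel₀ _ hE]
      simp only [ht, inner_eq_sum, crossCLM_apply]; simp; ring
    · rw [real_inner_smul_left, hW.normal_dY, inner_crossCLM_self, mul_zero]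
  have hsq : Set.EqOn (t ^ 2) (metricE X ^ 2) Set.univ := fun z _ => by
    have hE := (hW.metricE_pos z).ne'
    have h := inner_crossCLM_crossCLM (dY X z) (ν z)
    rw [hy, real_inner_smul_left, real_inner_smul_right, inner_dX_dX, hW.inner_dY_dY,
      hW.normal_dY, hW.inner_normal_self] at h
    simp only [Pi.pow_apply]
    field_simp at h
    linarith
  have hcont : Continuous t := by
    have : t = fun z => inner ℝ (crossCLM (dY X z) (ν z)) (dX X z) := rfl
    simp only [inner_eq_sum, crossCLM_apply] at this
    rw [this]
    have c1 := sx.continuous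
    have c2 := sy.continuous
    have c3 := hW.smooth_normal.continuous
    simp
    fun_prop
  rcases isPreconnected_univ.eq_or_eq_neg_of_sq_eq hcont.continuousOn
    hW.contDiff_metricE.continuous.continuousOn hsq
    (fun {z} _ => (hW.metricE_pos z).ne') with h | h
  · refine ⟨1, by norm_num, fun z => ?_⟩
    have : t z / metricE X z = 1 := by
      rw [h (Set.mem_univ z), div_self (hW.metricE_pos z).ne']
    rw [hx, hy, this]; simp
  · refine ⟨-1, by norm_num, fun z => ?_⟩
    have : t z / metricE X z = -1 := by
      rw [h (Set.mem_univ z), Pi.neg_apply, neg_div, div_self (hW.metricE_pos z).ne']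
    rw [hx, hy, this]; simp

/-- A Killing field along the surface which is everywhere tangent has constant coefficients
`p, q` with respect to `X_x, X_y`: Killing's equation, in conformal coordinates, contains the
Cauchy–Riemann equations for `p + i q`, and Liouville's theorem applies. -/
lemma exists_const_coeff_of_tangent [DiscreteTopology Γ] [IsZLattice ℝ Γ]
    (hW : IsSymmetricWenteTorus Γ H X ν) {a b : E3}
    (h : ∀ z, rigidNormalPart X ν a b z = 0) :
    ∃ p q : ℝ, ∀ z, rigidField a b (X z) = p • dX X z + q • dY X z := by
  have sx := contDiff_dX hW.smooth
  have sy := contDiff_dY hW.smooth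
  have sE := hW.contDiff_metricE
  have dE := differentiable_of_smooth sE
  have hE (z : ℂ) : metricE X z ≠ 0 := (hW.metricE_pos z).ne'
  set T : ℂ → E3 := fun z => rigidField a b (X z) with hT
  have sT : ContDiff ℝ ∞ T := hW.contDiff_rigidField a b
  have dTx : dX T = fun w => crossCLM b (dX X w) :=
    dX_const_add_clm_comp a (crossCLM b) hW.smooth
  have dTy : dY T = fun w => crossCLM b (dY X w) :=
    dY_const_add_clm_comp a (crossCLM b) hW.smooth
  have pT : IsPeriodic Γ T := fun γ hγ z => by simp only [hT, hW.periodic γ hγ z]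
  have pE : IsPeriodic Γ (metricE X) := fun γ hγ z => by
    simp only [metricE, isPeriodic_dX hW.periodic γ hγ z]
  set p : ℂ → ℝ := fun z => inner ℝ (T z) (dX X z) / metricE X z with hp
  set q : ℂ → ℝ := fun z => inner ℝ (T z) (dY X z) / metricE X z with hq
  have hpE : (fun z => p z * metricE X z) = fun z => inner ℝ (T z) (dX X z) :=
    funext fun z => div_mul_cancel₀ _ (hE z)
  have hqE : (fun z => q z * metricE X z) = fun z => inner ℝ (T z) (dY X z) :=
    funext fun z => div_mul_cancel₀ _ (hE z)
  have dp : Differentiable ℝ p := differentiable_of_smooth ((sT.inner ℝ sx).div sE hE)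
  have dq : Differentiable ℝ q := differentiable_of_smooth ((sT.inner ℝ sy).div sE hE)
  have pp : IsPeriodic Γ p := fun γ hγ z => by
    simp only [hp, pT γ hγ z, pE γ hγ z, isPeriodic_dX hW.periodic γ hγ z]
  have pq : IsPeriodic Γ q := fun γ hγ z => by
    simp only [hq, pT γ hγ z, pE γ hγ z, isPeriodic_dY hW.periodic γ hγ z]
  have hTpq (z : ℂ) : T z = p z • dX X z + q z • dY X z := by
    apply hW.ext_frame z
    · rw [inner_add_left, real_inner_smul_left, real_inner_smul_left, hW.inner_dY_dX,
        inner_dX_dX, ← congrFun hpE z]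
      ring
    · rw [inner_add_left, real_inner_smul_left, real_inner_smul_left, hW.conformal_angle,
        hW.inner_dY_dY, ← congrFun hqE z]
      ring
    · rw [inner_add_left, real_inner_smul_left, real_inner_smul_left, hW.normal_dX,
        hW.normal_dY, mul_zero, mul_zero, add_zero]
      exact h z
  have hmul {r : ℂ → ℝ} (dr : Differentiable ℝ r) (z v : ℂ) :
      fderiv ℝ (fun w => r w * metricE X w) z v
        = r z * fderiv ℝ (metricE X) z v + metricE X z * fderiv ℝ r z v := by
    rw [fderiv_fun_mul (dr z) (dE z)]; simp
  have hpx (z : ℂ) : p z * dX (metricE X) z + metricE X z * dX p z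
      = p z * (dX (metricE X) z / 2) + q z * (-dY (metricE X) z / 2) := by
    have e := dX_inner sT sx z
    rw [← hpE, dTx, inner_crossCLM_self, zero_add, hTpq, inner_add_left, real_inner_smul_left,
      real_inner_smul_left, real_inner_comm, hW.inner_dXdX_dX, real_inner_comm,
      hW.inner_dXdX_dY] at e
    exact (hmul dp z 1).symm.trans e
  have hqy (z : ℂ) : q z * dY (metricE X) z + metricE X z * dY q z
      = p z * (-dX (metricE X) z / 2) + q z * (dY (metricE X) z / 2) := by
    have e := dY_inner sT sy z
    rw [← hqE, dTy, inner_crossCLM_self, zero_add, hTpq, inner_add_left, real_inner_smul_left,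
      real_inner_smul_left, real_inner_comm, hW.inner_dYdY_dX, real_inner_comm,
      hW.inner_dYdY_dY] at e
    exact (hmul dq z Complex.I).symm.trans e
  have hpy (z : ℂ) : p z * dY (metricE X) z + metricE X z * dY p z
      = inner ℝ (crossCLM b (dY X z)) (dX X z)
        + (p z * (dY (metricE X) z / 2) + q z * (dX (metricE X) z / 2)) := by
    have e := dY_inner sT sx z
    rw [← hpE, dTy, hTpq, inner_add_left, real_inner_smul_left, real_inner_smul_left,
      real_inner_comm _ (dX X z), hW.inner_dYdX_dX, real_inner_comm _ (dY X z),
      hW.inner_dYdX_dY] at e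
    exact (hmul dp z Complex.I).symm.trans e
  have hqx (z : ℂ) : q z * dX (metricE X) z + metricE X z * dX q z
      = inner ℝ (crossCLM b (dX X z)) (dY X z)
        + (p z * (dY (metricE X) z / 2) + q z * (dX (metricE X) z / 2)) := by
    have e := dX_inner sT sy z
    rw [← hqE, dTx, hTpq, inner_add_left, real_inner_smul_left, real_inner_smul_left,
      dX_dY_comm hW.smooth, real_inner_comm _ (dX X z), hW.inner_dYdX_dX,
      real_inner_comm _ (dY X z), hW.inner_dYdX_dY] at e
    exact (hmul dq z 1).symm.trans e
  have hconst := const_of_cauchyRiemann dp dq pp pq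
    (fun z => mul_left_cancel₀ (hE z) (by linarith [hpx z, hqy z]))
    (fun z => mul_left_cancel₀ (hE z) (by
      linarith [hpy z, hqx z, inner_crossCLM_swap b (dX X z) (dY X z)]))
  exact ⟨p 0, q 0, fun z => by rw [← (hconst z).1, ← (hconst z).2]; exact hTpq z⟩

/-- A vector orthogonal to all tangent planes is zero, as the principal curvature in the direction
of `x` does not vanish. -/
lemma eq_zero_of_inner_tangent_eq_zero (hW : IsSymmetricWenteTorus Γ H X ν) {b : E3}
    (hx : ∀ z, inner ℝ b (dX X z) = 0) (hy : ∀ z, inner ℝ b (dY X z) = 0) : b = 0 := by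
  have hn : inner ℝ b (ν 0) = 0 := by
    have h0 : b = inner ℝ b (ν 0) • ν 0 := by
      apply hW.ext_frame 0
      · rw [hx, real_inner_smul_left, hW.inner_normal_dX, mul_zero]
      · rw [hy, real_inner_smul_left, hW.inner_normal_dY, mul_zero]
      · rw [real_inner_smul_left, hW.inner_normal_self, mul_one]
    have h1 : inner ℝ (dX (fun _ => b) 0) (dX X 0) + inner ℝ b (dX (dX X) 0) = 0 :=
      dX_inner_eq_zero contDiff_const (contDiff_dX hW.smooth) hx 0
    have h2 : dX (fun _ : ℂ => b) 0 = 0 := by simp [dX]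
    have h3 := hW.sffL_eq 0
    have hE := hW.metricE_pos 0
    have hH := hW.pos
    rw [h2, inner_zero_left, zero_add, h0, real_inner_smul_left,
      real_inner_comm (dX (dX X) 0)] at h1
    rw [sffL] at h3
    rcases mul_eq_zero.1 h1 with h | h
    · exact h
    · have : 0 < H * metricE X 0 := by positivity
      linarith
  apply hW.ext_frame 0
  · rw [hx, inner_zero_left]
  · rw [hy, inner_zero_left]
  · rw [hn, inner_zero_left]

/-- No nontrivial infinitesimal rigid motion is everywhere tangent to the surface. -/
lemma eq_zero_of_rigidNormalPart_eq_zero [DiscreteTopology Γ] [IsZLattice ℝ Γ]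
    (hW : IsSymmetricWenteTorus Γ H X ν) {a b : E3}
    (h : ∀ z, rigidNormalPart X ν a b z = 0) : a = 0 ∧ b = 0 := by
  obtain ⟨p, q, hT⟩ := hW.exists_const_coeff_of_tangent h
  obtain ⟨s, hs, hor⟩ := hW.exists_orientation
  have hH := hW.pos
  have hHE (z : ℂ) : 0 < H * metricE X z := mul_pos hH (hW.metricE_pos z)
  have sT := hW.contDiff_rigidField a b
  have sν := hW.smooth_normal
  have dTx : dX (fun w => rigidField a b (X w)) = fun w => crossCLM b (dX X w) :=
    dX_const_add_clm_comp a (crossCLM b) hW.smooth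
  have dTy : dY (fun w => rigidField a b (X w)) = fun w => crossCLM b (dY X w) :=
    dY_const_add_clm_comp a (crossCLM b) hW.smooth
  -- The derivatives of `⟪a + b × X, ν⟫ = 0` determine the tangential part of `b`.
  have hby (z : ℂ) : inner ℝ b (dY X z) = s * p * (H * metricE X z + 1) := by
    have e := dX_inner_eq_zero sT sν h z
    have hE := (hW.metricE_pos z).ne'
    rw [dTx, inner_crossCLM_rotate, (hor z).1, hW.dX_normal, hT, real_inner_smul_left,
      real_inner_smul_right, inner_add_left, real_inner_smul_left, real_inner_smul_left,
      inner_dX_dX, hW.inner_dY_dX, real_inner_comm b] at e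
    have e' : -(s * inner ℝ b (dY X z)) + (H * metricE X z + 1) * p = 0 := by
      field_simp at e
      exact mul_left_cancel₀ hE (by linear_combination e)
    linear_combination -s * e' - inner ℝ b (dY X z) * hs
  have hbx (z : ℂ) : inner ℝ b (dX X z) = -(s * q * (H * metricE X z - 1)) := by
    have e := dY_inner_eq_zero sT sν h z
    have hE := (hW.metricE_pos z).ne'
    rw [dTy, inner_crossCLM_rotate, (hor z).2, hW.dY_normal, hT, real_inner_smul_left,
      real_inner_smul_right, inner_add_left, real_inner_smul_left, real_inner_smul_left,
      hW.inner_dY_dY, hW.conformal_angle, real_inner_comm b] at e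
    have e' : s * inner ℝ b (dX X z) + (H * metricE X z - 1) * q = 0 := by
      field_simp at e
      exact mul_left_cancel₀ hE (by linear_combination e)
    linear_combination s * e' - inner ℝ b (dX X z) * hs
  have hgd (c : E3) (z v : ℂ) :
      fderiv ℝ (fun w => (inner ℝ c (X w) : ℝ)) z v = inner ℝ c (fderiv ℝ X z v) := by
    simpa using fderiv_const_add_clm_comp (0 : ℝ) (innerSL ℝ c) hW.smooth z v
  have hgdiff (c : E3) : Differentiable ℝ (fun w => (inner ℝ c (X w) : ℝ)) :=
    differentiable_of_smooth (contDiff_const.inner ℝ hW.smooth)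
  have hgper (c : E3) : IsPeriodic Γ (fun w => (inner ℝ c (X w) : ℝ)) := fun γ hγ z => by
    simp only [hW.periodic γ hγ z]
  -- Along the flow of the field, `⟪b, X⟫` grows at the constant rate `2 s p q`.
  have hpq : p = 0 ∨ q = 0 := by
    have : s * (2 * p * q) = 0 :=
      eq_zero_of_fderiv_const (hgper b) (hgdiff b) (v := ⟨p, q⟩) fun z => by
        rw [hgd, fderiv_eq_dX_dY, inner_add_right, real_inner_smul_right, real_inner_smul_right,
          hbx, hby]
        ring
    have hs0 : s ≠ 0 := fun h0 => by simp [h0] at hs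
    simpa [hs0] using this
  have hp : p = 0 := by
    rcases hpq with hp | hq
    · exact hp
    -- For `q = 0`, the function `⟪b, X⟫` only depends on `y`, and is strictly monotone unless
    -- `p = 0`; the factor `s * p` makes its derivative nonnegative.
    · have := fderiv_eq_zero_of_nonneg (f := fun w => inner ℝ ((s * p) • b) (X w)) (hgper _)
        (hgdiff _) linearIndependent_one_I
        (fun z => by
          rw [hgd, real_inner_smul_left]
          exact mul_eq_zero_of_right _ ((hbx z).trans (by rw [hq]; ring)))
        (fun z => by
          rw [hgd, real_inner_smul_left]
          refine le_of_le_of_eq ?_ (congrArg _ (hby z).symm)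
          have := hHE z
          have e : s * p * (s * p * (H * metricE X z + 1)) =
            (s * p) ^ 2 * (H * metricE X z + 1) := by ring
          rw [e]
          positivity) 0
      rw [hgd, real_inner_smul_left] at this
      have e := (congrArg (s * p * ·) (hby 0)).symm.trans this
      have h3 : (s * s) * p ^ 2 * (H * metricE X 0 + 1) = 0 := by linear_combination e
      have h4 := hHE 0
      have h5 : H * metricE X 0 + 1 ≠ 0 := by positivity
      rw [hs, one_mul] at h3
      simpa [h5] using h3
  subst hp
  have hby0 (z : ℂ) : inner ℝ b (dY X z) = 0 := by rw [hby]; ring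
  have hνd (c : E3) (z v : ℂ) :
      fderiv ℝ (fun w => (inner ℝ c (ν w) : ℝ)) z v = inner ℝ c (fderiv ℝ ν z v) := by
    simpa using fderiv_const_add_clm_comp (0 : ℝ) (innerSL ℝ c) sν z v
  -- For `p = 0`, the function `s q ⟪b, ν - 2 H X⟫` only depends on `x`. The factor `2 H` completes
  -- the square: its derivative is `q ^ 2 * (H * E - 1) ^ 2 / E`.
  have hbx0 (z : ℂ) : inner ℝ b (dX X z) = 0 := by
    set c : E3 := (s * q) • b with hc
    set f : ℂ → ℝ := fun w => inner ℝ c (ν w) - 2 * H * inner ℝ c (X w) with hf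
    have dν : Differentiable ℝ (fun w => (inner ℝ c (ν w) : ℝ)) :=
      differentiable_of_smooth (contDiff_const.inner ℝ sν)
    have df : Differentiable ℝ f := dν.sub ((hgdiff c).const_mul _)
    have pf : IsPeriodic Γ f := fun γ hγ z => by
      simp only [hf, hW.periodic γ hγ z, hW.periodic_normal γ hγ z]
    have hfd (z v : ℂ) : fderiv ℝ f z v
        = inner ℝ c (fderiv ℝ ν z v) - 2 * H * inner ℝ c (fderiv ℝ X z v) := by
      rw [hf, fderiv_fun_sub (dν z) (((hgdiff c).const_mul _) z),
        fderiv_const_mul (hgdiff c z)]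
      simp [hgd, hνd]
    have hfy (z : ℂ) : fderiv ℝ f z Complex.I = 0 := by
      rw [hfd]
      change inner ℝ c (dY ν z) - 2 * H * inner ℝ c (dY X z) = 0
      rw [hW.dY_normal, real_inner_smul_right, hc, real_inner_smul_left, hby0]
      ring
    have hfx (z : ℂ) : fderiv ℝ f z 1 = q ^ 2 * (H * metricE X z - 1) ^ 2 / metricE X z := by
      have hE := (hW.metricE_pos z).ne'
      rw [hfd]
      change inner ℝ c (dX ν z) - 2 * H * inner ℝ c (dX X z) = _
      rw [hW.dX_normal, real_inner_smul_right, hc, real_inner_smul_left, hbx]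
      field_simp
      linear_combination q ^ 2 * (H * metricE X z - 1) ^ 2 * hs
    have h0 := fderiv_eq_zero_of_nonneg pf df linearIndependent_I_one hfy (fun z => by
      rw [hfx]
      have := hW.metricE_pos z
      positivity) z
    rw [hfx, div_eq_zero_iff, or_iff_left (hW.metricE_pos z).ne', ← mul_pow,
      sq_eq_zero_iff] at h0
    rw [hbx]
    linear_combination -s * h0
  have hb : b = 0 := hW.eq_zero_of_inner_tangent_eq_zero hbx0 hby0
  -- What remains is the translation `a = q X_y`, for which `⟪q a, X⟫` is monotone in `y`.
  subst hb
  have hT' (z : ℂ) : a = q • dY X z := by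
    have h0 : crossCLM 0 (X z) = 0 := crossCLM_zero_left _
    simpa [rigidField_eq, h0] using hT z
  have hq := fderiv_eq_zero_of_nonneg (hgper (q • a)) (hgdiff (q • a)) linearIndependent_one_I
    (fun z => by
      rw [hgd]
      change inner ℝ (q • a) (dX X z) = 0
      rw [hT' z, real_inner_smul_left, real_inner_smul_left, hW.inner_dY_dX, mul_zero, mul_zero])
    (fun z => by
      rw [hgd]
      change 0 ≤ inner ℝ (q • a) (dY X z)
      rw [hT' z, real_inner_smul_left, real_inner_smul_left, hW.inner_dY_dY, ← mul_assoc]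
      exact mul_nonneg (mul_self_nonneg q) (hW.metricE_pos z).le) 0
  rw [hgd] at hq
  change inner ℝ (q • a) (dY X 0) = 0 at hq
  rw [hT' 0, real_inner_smul_left, real_inner_smul_left, hW.inner_dY_dY, ← mul_assoc] at hq
  have hq0 : q = 0 :=
    mul_self_eq_zero.1 ((mul_eq_zero.1 hq).resolve_right (hW.metricE_pos 0).ne')
  exact ⟨by rw [hT' 0, hq0, zero_smul], rfl⟩

end IsSymmetricWenteTorus

/-! ### The nullity -/

/-- The normal parts of infinitesimal rigid motions, as a linear function of the pair `(a, b)`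
that defines the motion. -/
noncomputable def rigidNormalPartLM (X ν : ℂ → E3) : E3 × E3 →ₗ[ℝ] (ℂ → ℝ) where
  toFun ab := rigidNormalPart X ν ab.1 ab.2
  map_add' u v := funext fun z => by
    simp [rigidNormalPart, inner_eq_sum, rigidField_eq, crossCLM_apply]; ring
  map_smul' c u := funext fun z => by
    simp [rigidNormalPart, inner_eq_sum, rigidField_eq, crossCLM_apply]; ring

lemma IsSymmetricWenteTorus.six_le_nullity {Γ : Submodule ℤ ℂ} [DiscreteTopology Γ]
    [IsZLattice ℝ Γ] {H : ℝ} {X ν : ℂ → E3} (hW : IsSymmetricWenteTorus Γ H X ν) :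
    6 ≤ nullity Γ H X := by
  let f : E3 × E3 →ₗ[ℝ] jacobiFields Γ H X := (rigidNormalPartLM X ν).codRestrict _
    fun ab => hW.rigidNormalPart_mem_jacobiFields ab.1 ab.2
  have hf : Function.Injective f := by
    refine (injective_iff_map_eq_zero f).2 fun ab h => ?_
    have h' : rigidNormalPart X ν ab.1 ab.2 = 0 := congrArg Subtype.val h
    have := hW.eq_zero_of_rigidNormalPart_eq_zero fun z => congrFun h' z
    exact Prod.ext this.1 this.2
  have h6 : Module.rank ℝ (E3 × E3) = 6 := by
    rw [← Module.finrank_eq_rank, Module.finrank_prod, finrank_euclideanSpace_fin]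
    norm_num
  exact h6 ▸ LinearMap.rank_le_of_injective f hf

end Wente

theorem lemma2p5 (Γ : Submodule ℤ ℂ) [DiscreteTopology Γ] [IsZLattice ℝ Γ] (H : ℝ)
    (X ν : ℂ → Wente.E3) (hW : Wente.IsSymmetricWenteTorus Γ H X ν) :
    (∀ a b : Wente.E3, Wente.rigidNormalPart X ν a b ∈ Wente.jacobiFields Γ H X) ∧
    (∀ a b : Wente.E3, (∀ z, Wente.rigidNormalPart X ν a b z = 0) → a = 0 ∧ b = 0) ∧
    6 ≤ Wente.nullity Γ H X :=
  ⟨hW.rigidNormalPart_mem_jacobiFields, fun _ _ => hW.eq_zero_of_rigidNormalPart_eq_zero,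
    hW.six_le_nullity⟩
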